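/- All graphs are finite and simple. Let $G$ be a graph with some vertices colored blue and the others white. The color change rule allows a blue vertex $u$ to turn a white vertex $w$ blue if $w$ is the unique white neighbor of $u$. A set $B\subseteq V(G)$ is a zero forcing set if, starting with exactly the vertices of $B$ blue, repeated application of the rule eventually colors all vertices blue; it is a minimum zero forcing set if it has the least cardinality among all zero forcing sets of $G$. The zero forcing graph $\mathscr{Z}(G)$ has the minimum zero forcing sets of $G$ as vertices, and two of them, $B$ and $B'$, are adjacent if and only if their symmetric difference has exactly two elements. Theorem. For every tree $T$, the graph $\mathscr{Z}(T)$ is $\{C_3,C_4\}$-free, that is, it has no subgraph isomorphic to the cycle $C_3$ and no subgraph isomorphic to the cycle $C_4$, if and only if $T$ is a path (where a path may have any order $n\ge 1$). -/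

import Mathlib

namespace SimpleGraph

variable {V : Type*} [Fintype V] [DecidableEq V]

/-- One application of the color change rule of zero forcing: `S` is the current set of blue
vertices, a blue vertex `u` whose unique white neighbor is `w` changes the color of `w` to blue,
and `S'` is the resulting set of blue vertices. -/
def ColorChange (G : SimpleGraph V) (S S' : Finset V) : Prop :=
  ∃ u ∈ S, ∃ w, w ∉ S ∧ G.Adj u w ∧ (∀ x, x ∉ S → G.Adj u x → x = w) ∧ S' = insert w S

/-- `B` is a zero forcing set: starting with exactly the vertices of `B` blue, finitely many
applications (possibly none) of the color change rule color all vertices blue. -/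
def IsZeroForcingSet (G : SimpleGraph V) (B : Finset V) : Prop :=
  Relation.ReflTransGen G.ColorChange B Finset.univ

/-- The zero forcing number `Z(G)`: the minimum cardinality of a zero forcing set. (The set below
is nonempty, since the set of all vertices is a zero forcing set.) -/
noncomputable def zeroForcingNumber (G : SimpleGraph V) : ℕ :=
  sInf {k | ∃ B : Finset V, G.IsZeroForcingSet B ∧ B.card = k}

/-- Minimum zero forcing sets: zero forcing sets of cardinality `Z(G)`. -/
def IsMinimumZeroForcingSet (G : SimpleGraph V) (B : Finset V) : Prop :=
  G.IsZeroForcingSet B ∧ B.card = G.zeroForcingNumber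

/-- The zero forcing graph of `G`: the vertices are the minimum zero forcing sets of `G`, and two
of them are adjacent iff their symmetric difference has exactly two elements (as they have the same
cardinality, iff one is obtained from the other by exchanging a single vertex). -/
def zeroForcingGraph (G : SimpleGraph V) :
    SimpleGraph {B : Finset V // G.IsMinimumZeroForcingSet B} where
  Adj B B' := (symmDiff B.1 B'.1).card = 2
  symm := ⟨fun B B' h => by rw [symmDiff_comm]; exact h⟩
  loopless := ⟨fun B h => by simp at h⟩

/-- `G` is a path: it is isomorphic to the path `P_n` on `n` vertices for some `n ≥ 1`. -/
def IsPathGraph {W : Type*} (G : SimpleGraph W) : Prop :=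
  ∃ n : ℕ, 1 ≤ n ∧ Nonempty (G ≃g pathGraph n)

end SimpleGraph

/-! ### Oriented path covers of a forest -/

namespace SimpleGraph

variable {V : Type*}

/-! In a forest, zero forcing sets are exactly the sets of initial vertices of oriented path covers.
Forcing chains always give such a cover (`IsZeroForcingSet.exists_isPathCover`); acyclicity gives
the converse (`IsPathCover.isZeroForcingSet`). `IsPathCover` itself rules out only directed
2-cycles, since longer ones cannot occur in a forest. Hence any chain may be reversed, and chains
may be re-routed, without losing the forcing property.

Take a minimum zero forcing set `B` of a tree and its chains. Two nontrivial chains, reversed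
independently, give four minimum sets in a 4-cycle. If a chain is a single vertex `x` and is not the
only one, minimality makes each neighbor `q` of `x` interior to its chain `b → ⋯ → q → r → ⋯`.
Cutting `q → r` and adding `q → x` exchanges `x` for `r`; reversing `b → ⋯ → q → x` then exchanges
`b` for `x`. So `B`, `B - x + r` and `B - b + r` form a triangle. With neither cycle there is only
one chain, and the tree is a path. Conversely, a path has at most two minimum sets, its ends as
singletons, too few for any cycle. -/

/-- A decomposition of the vertex set into oriented paths of `G`, given by its successor relation
`F`, with set of initial vertices `B`. -/
structure IsPathCover (G : SimpleGraph V) (F : V → V → Prop) (B : Finset V) : Prop where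
  adj : ∀ {u v}, F u v → G.Adj u v
  left : ∀ {u u' v}, F u v → F u' v → u = u'
  right : ∀ {u v v'}, F u v → F u v' → v = v'
  asymm : ∀ {u v}, F u v → ¬ F v u
  mem_iff : ∀ {v}, v ∈ B ↔ ∀ u, ¬ F u v

/-- A finite acyclic graph has no infinite non-backtracking walk. -/
theorem IsAcyclic.not_of_forall_exists_ne [Finite V] {G : SimpleGraph V} (hG : G.IsAcyclic)
    {D : V → V → Prop} (hadj : ∀ a b, D a b → G.Adj a b)
    (hD : ∀ a b, D a b → ∃ c, D b c ∧ c ≠ a) (a b : V) : ¬ D a b := by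
  intro hab
  have key : ∀ n : ℕ, ∃ u a b : V, ∃ p : G.Walk u a, ∃ h : G.Adj a b,
      D a b ∧ (p.concat h).IsPath ∧ p.length = n := by
    intro n
    induction n with
    | zero =>
      refine ⟨a, a, b, .nil, hadj a b hab, hab, ?_, rfl⟩
      exact (Walk.IsPath.nil).concat (by simpa using (hadj a b hab).ne') _
    | succ n ih =>
      obtain ⟨u, a, b, p, h, hab, hp, hl⟩ := ih
      obtain ⟨c, hbc, hca⟩ := hD a b hab
      refine ⟨u, b, c, p.concat h, hadj b c hbc, hbc, ?_, by simp [hl]⟩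
      refine hp.concat (fun hc => hca ?_) _
      -- In a forest, the only vertex of a path adjacent to its end is the penultimate one.
      have := hG.eq_penultimate_of_adj_end hp (hadj b c hbc) hc
      simpa using this
  have := Fintype.ofFinite V
  obtain ⟨u, a, b, p, h, -, hp, hl⟩ := key (Fintype.card V)
  have := hp.length_lt
  simp at this
  omega

namespace IsPathCover

variable {G : SimpleGraph V} {F : V → V → Prop} {B : Finset V}

/-- Otherwise following successors from `b` never stops; by `asymm` this walk never backtracks. -/
theorem exists_terminal [Finite V] (hF : G.IsPathCover F B) (hG : G.IsAcyclic) (b : V) :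
    ∃ e, Relation.ReflTransGen F b e ∧ ∀ w, ¬ F e w := by
  by_contra! h
  obtain ⟨c, hc⟩ := h b .refl
  refine hG.not_of_forall_exists_ne (D := fun x y => F x y ∧ Relation.ReflTransGen F b x)
    (fun x y h => hF.adj h.1) ?_ b c ⟨hc, .refl⟩
  rintro x y ⟨hxy, hx⟩
  obtain ⟨z, hz⟩ := h y (hx.tail hxy)
  exact ⟨z, ⟨hz, hx.tail hxy⟩, fun hzx => hF.asymm hxy (hzx ▸ hz)⟩

theorem not_reflTransGen_of_rel [Finite V] (hF : G.IsPathCover F B) (hG : G.IsAcyclic) {q r : V}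
    (hqr : F q r) : ¬ Relation.ReflTransGen F r q := by
  intro h
  refine hG.not_of_forall_exists_ne (D := fun x y => F x y ∧ Relation.ReflTransGen F y x)
    (fun x y h => hF.adj h.1) ?_ q r ⟨hqr, h⟩
  rintro x y ⟨hxy, hyx⟩
  rcases hyx.cases_head with rfl | ⟨z, hyz, hzx⟩
  · exact absurd rfl (hF.adj hxy).ne
  · exact ⟨z, ⟨hyz, hzx.tail hxy⟩, fun hz => hF.asymm hxy (hz ▸ hyz)⟩

theorem exists_flip [Fintype V] (hF : G.IsPathCover F B) :
    ∃ B', G.IsPathCover (flip F) B' := by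
  classical
  refine ⟨Finset.univ.filter fun v => ∀ w, ¬ F v w, ?_, ?_, ?_, ?_, ?_⟩
  · exact fun h => (hF.adj h).symm
  · exact fun h h' => hF.right h h'
  · exact fun h h' => hF.left h h'
  · exact fun h h' => hF.asymm h h'
  · simp [flip]

theorem exists_initial [Fintype V] (hF : G.IsPathCover F B) (hG : G.IsAcyclic) (v : V) :
    ∃ b ∈ B, Relation.ReflTransGen F b v := by
  obtain ⟨B', hB'⟩ := hF.exists_flip
  obtain ⟨b, hb, hb'⟩ := hB'.exists_terminal hG v
  refine ⟨b, hF.mem_iff.2 hb', ?_⟩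
  rw [← Relation.reflTransGen_swap]
  exact hb

/-- The chain starting in an initial vertex is closed under successors and predecessors. -/
theorem mem_chain_iff (hF : G.IsPathCover F B) {b x y : V} (hb : b ∈ B) (hxy : F x y) :
    Relation.ReflTransGen F b x ↔ Relation.ReflTransGen F b y := by
  refine ⟨fun h => h.tail hxy, fun h => ?_⟩
  rcases h.cases_tail with rfl | ⟨z, hz, hzy⟩
  · exact absurd hxy (hF.mem_iff.1 hb x)
  · exact hF.left hxy hzy ▸ hz

theorem chain_initial (hF : G.IsPathCover F B) {b v : V} (hv : v ∈ B)
    (h : Relation.ReflTransGen F b v) : v = b := by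
  rcases h.cases_tail with rfl | ⟨z, hz, hzy⟩
  · rfl
  · exact absurd hzy (hF.mem_iff.1 hv z)

theorem chain_terminal (hF : G.IsPathCover F B) {b e v : V} (he : ∀ w, ¬ F e w)
    (hv : ∀ w, ¬ F v w) (hbe : Relation.ReflTransGen F b e) (hbv : Relation.ReflTransGen F b v) :
    v = e := by
  rcases Relation.ReflTransGen.total_of_right_unique (r := F) (fun _ _ _ h h' => hF.right h h')
    hbe hbv
    with h | h
  · rcases h.cases_head with rfl | ⟨z, hz, -⟩
    · rfl
    · exact absurd hz (he z)
  · rcases h.cases_head with rfl | ⟨z, hz, -⟩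
    · rfl
    · exact absurd hz (hv z)

theorem chain_disjoint (hF : G.IsPathCover F B) {b c v : V} (hb : b ∈ B) (hc : c ∈ B)
    (h : Relation.ReflTransGen F b v) (h' : Relation.ReflTransGen F c v) : b = c := by
  rcases Relation.ReflTransGen.total_of_right_unique (r := flip F) (a := v) (b := b) (c := c)
    (fun _ _ _ h h' => hF.left h h') (Relation.reflTransGen_swap.2 h)
    (Relation.reflTransGen_swap.2 h') with h | h
  · exact hF.chain_initial hb (Relation.reflTransGen_swap.1 h)
  · exact (hF.chain_initial hc (Relation.reflTransGen_swap.1 h)).symm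

/-- Reversing the orientation of a union of chains. -/
theorem reverse (hF : G.IsPathCover F B) {C : Set V} (hC : ∀ x y, F x y → (x ∈ C ↔ y ∈ C))
    {B' : Finset V} (hB' : ∀ v, v ∈ B' ↔ (v ∈ C ∧ ∀ w, ¬ F v w) ∨ (v ∉ C ∧ v ∈ B)) :
    G.IsPathCover (fun x y => (x ∈ C ∧ F y x) ∨ (x ∉ C ∧ F x y)) B' := by
  refine ⟨?_, ?_, ?_, ?_, ?_⟩
  · rintro u v (⟨-, h⟩ | ⟨-, h⟩)
    exacts [(hF.adj h).symm, hF.adj h]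
  · have := @hF.left; have := @hF.right; grind
  · have := @hF.left; have := @hF.right; grind
  · have := @hF.asymm; grind
  · have := @hF.mem_iff; grind

/-! ### Path covers and zero forcing sets -/

theorem isZeroForcingSet_aux [Fintype V] [DecidableEq V] (hF : G.IsPathCover F B)
    (hG : G.IsAcyclic) (n : ℕ) : ∀ S : Finset V, Sᶜ.card = n → B ⊆ S →
    (∀ u v, F u v → v ∈ S → u ∈ S) → G.IsZeroForcingSet S := by
  induction n with
  | zero =>
    intro S hS _ _
    have : S = Finset.univ := by simpa using hS
    subst this
    exact .refl
  | succ n ih =>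
    intro S hS hBS hpred
    have hprev : ∀ v, v ∉ S → ∃ u, F u v := by
      intro v hv
      by_contra! h
      exact hv (hBS (hF.mem_iff.2 h))
    obtain ⟨u, w, hu, hw, huw, hun⟩ : ∃ u w, u ∈ S ∧ w ∉ S ∧ F u w ∧
        ∀ x, x ∉ S → G.Adj u x → x = w := by
      by_contra! hstuck
      obtain ⟨w, hw⟩ : Sᶜ.Nonempty := by rw [← Finset.card_pos]; omega
      rw [Finset.mem_compl] at hw
      obtain ⟨u, hu⟩ := hprev w hw
      -- If no force is possible, an endless walk arises: from a white vertex step back to its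
      -- predecessor, and from a blue vertex reached this way step to another white neighbor, which
      -- exists because the force is blocked.
      refine hG.not_of_forall_exists_ne
        (D := fun a b => (a ∉ S ∧ F b a) ∨ (b ∉ S ∧ G.Adj a b ∧ ¬ F a b)) ?_ ?_ w u (.inl ⟨hw, hu⟩)
      · rintro a b (⟨-, h⟩ | ⟨-, h, -⟩)
        exacts [(hF.adj h).symm, h]
      · rintro a b (⟨ha, h⟩ | ⟨hb, hab, hnab⟩)
        · by_cases hb : b ∈ S
          · obtain ⟨x, hx, hbx, hxa⟩ := hstuck b a hb ha h
            exact ⟨x, .inr ⟨hx, hbx, fun h' => hxa (hF.right h' h)⟩, hxa⟩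
          · obtain ⟨c, hc⟩ := hprev b hb
            exact ⟨c, .inl ⟨hb, hc⟩, fun h' => hF.asymm h (h' ▸ hc)⟩
        · obtain ⟨c, hc⟩ := hprev b hb
          exact ⟨c, .inl ⟨hb, hc⟩, fun h' => hnab (h' ▸ hc)⟩
    refine Relation.ReflTransGen.head ⟨u, hu, w, hw, hF.adj huw, hun, rfl⟩ (ih (insert w S) ?_ ?_ ?_)
    · rw [Finset.card_compl] at hS ⊢
      rw [Finset.card_insert_of_notMem hw]
      omega
    · exact hBS.trans (Finset.subset_insert _ _)
    · intro x y hxy hy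
      rcases Finset.mem_insert.1 hy with rfl | hy
      · exact Finset.mem_insert_of_mem (hF.left huw hxy ▸ hu)
      · exact Finset.mem_insert_of_mem (hpred x y hxy hy)

/-- The initial vertices of a path cover of a forest form a zero forcing set. -/
theorem isZeroForcingSet [Fintype V] [DecidableEq V] (hF : G.IsPathCover F B)
    (hG : G.IsAcyclic) : G.IsZeroForcingSet B :=
  hF.isZeroForcingSet_aux hG _ B rfl subset_rfl
    fun u _ huv hv => absurd huv (hF.mem_iff.1 hv u)

end IsPathCover

variable [Fintype V] [DecidableEq V] {G T : SimpleGraph V} {B : Finset V}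

-- The last clause is the inductive invariant: once a vertex has forced, all its neighbors are blue,
-- so it never forces again and successors are unique.
omit [Fintype V] in
theorem exists_forcing_of_reflTransGen {S : Finset V}
    (h : Relation.ReflTransGen G.ColorChange B S) :
    ∃ F : V → V → Prop, (∀ u v, F u v → G.Adj u v) ∧ (∀ u u' v, F u v → F u' v → u = u') ∧
      (∀ u v v', F u v → F u v' → v = v') ∧ (∀ u v, F u v → ¬ F v u) ∧ B ⊆ S ∧
      (∀ u v, F u v → u ∈ S ∧ v ∈ S ∧ v ∉ B) ∧ (∀ v ∈ S, v ∉ B → ∃ u, F u v) ∧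
      (∀ u v, F u v → ∀ x, G.Adj u x → x ∈ S) := by
  induction h with
  | refl => exact ⟨fun _ _ => False, by simp⟩
  | @tail S S' _ hstep ih =>
    obtain ⟨F, hadj, hl, hr, ha, hBS, hmem, hex, hnb⟩ := ih
    obtain ⟨u, hu, w, hw, huw, hun, rfl⟩ := hstep
    have huF : ∀ v, ¬ F u v := fun v hv => hw (hnb u v hv w huw)
    refine ⟨fun x y => F x y ∨ (x = u ∧ y = w), ?_, ?_, ?_, ?_, ?_, ?_, ?_, ?_⟩
    · grind
    · grind
    · grind
    · grind
    · grind
    · grind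
    · intro v hv hvB
      rcases Finset.mem_insert.1 hv with rfl | hv
      · exact ⟨u, .inr ⟨rfl, rfl⟩⟩
      · exact (hex v hv hvB).imp fun _ => .inl
    · grind

/-- The forcing chains of a zero forcing set form a path cover. -/
theorem IsZeroForcingSet.exists_isPathCover (h : G.IsZeroForcingSet B) :
    ∃ F, G.IsPathCover F B := by
  obtain ⟨F, hadj, hl, hr, ha, -, hmem, hex, -⟩ := exists_forcing_of_reflTransGen h
  refine ⟨F, @hadj, @hl, @hr, @ha, ?_⟩
  intro v
  refine ⟨fun hv u huv => (hmem u v huv).2.2 hv, fun h => ?_⟩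
  by_contra hv
  obtain ⟨u, hu⟩ := hex v (Finset.mem_univ v) hv
  exact h u hu

theorem zeroForcingNumber_le_card (h : G.IsZeroForcingSet B) : G.zeroForcingNumber ≤ B.card :=
  Nat.sInf_le ⟨B, h, rfl⟩

theorem exists_isMinimumZeroForcingSet (G : SimpleGraph V) :
    ∃ B, G.IsMinimumZeroForcingSet B :=
  Nat.sInf_mem (s := {k | ∃ B : Finset V, G.IsZeroForcingSet B ∧ B.card = k})
    ⟨_, Finset.univ, .refl, rfl⟩

theorem IsMinimumZeroForcingSet.swap (hB : G.IsMinimumZeroForcingSet B) {b e : V} (hb : b ∈ B)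
    (he : e ∉ B) (h : G.IsZeroForcingSet (insert e (B.erase b))) :
    G.IsMinimumZeroForcingSet (insert e (B.erase b)) := by
  refine ⟨h, ?_⟩
  rw [← hB.2, Finset.card_insert_of_notMem (by simp [he]), Finset.card_erase_add_one hb]

omit [Fintype V] in
theorem card_symmDiff_swap {b e : V} (hb : b ∈ B) (he : e ∉ B) :
    (symmDiff B (insert e (B.erase b))).card = 2 := by
  have hbe : b ≠ e := fun h => he (h ▸ hb)
  have : symmDiff B (insert e (B.erase b)) = {b, e} := by
    ext v
    simp only [Finset.mem_symmDiff, Finset.mem_insert, Finset.mem_erase, Finset.mem_singleton]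
    grind
  rw [this, Finset.card_pair hbe]

/-- In a minimum path cover of a forest two paths cannot be merged. -/
theorem IsPathCover.rel_of_adj {F : V → V → Prop} (hF : G.IsPathCover F B) (hG : G.IsAcyclic)
    (hB : G.IsMinimumZeroForcingSet B) {x y : V} (hx : ∀ w, ¬ F x w) (hy : y ∈ B)
    (hxy : G.Adj x y) : F y x := by
  by_contra hyx
  have hcov : G.IsPathCover (fun a b => F a b ∨ (a = x ∧ b = y)) (B.erase y) := by
    have h1 := @hF.adj
    have h2 := @hF.left
    have h3 := @hF.right
    have h4 := @hF.asymm
    have h5 := @hF.mem_iff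
    have h6 := hxy.ne
    refine ⟨?_, ?_, ?_, ?_, ?_⟩ <;> grind
  have h1 := zeroForcingNumber_le_card (hcov.isZeroForcingSet hG)
  have h2 := Finset.card_erase_lt_of_mem hy
  have h3 := hB.2
  omega

/-! ### Short cycles from reversing and re-routing chains -/

theorem not_free_cycleGraph_three {B₁ B₂ B₃ : Finset V} (h₁ : G.IsMinimumZeroForcingSet B₁)
    (h₂ : G.IsMinimumZeroForcingSet B₂) (h₃ : G.IsMinimumZeroForcingSet B₃)
    (h₁₂ : (symmDiff B₁ B₂).card = 2) (h₂₃ : (symmDiff B₂ B₃).card = 2)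
    (h₁₃ : (symmDiff B₁ B₃).card = 2) : ¬ (cycleGraph 3).Free G.zeroForcingGraph := by
  have a₁₂ : G.zeroForcingGraph.Adj ⟨B₁, h₁⟩ ⟨B₂, h₂⟩ := h₁₂
  have a₂₃ : G.zeroForcingGraph.Adj ⟨B₂, h₂⟩ ⟨B₃, h₃⟩ := h₂₃
  have a₁₃ : G.zeroForcingGraph.Adj ⟨B₁, h₁⟩ ⟨B₃, h₃⟩ := h₁₃
  rw [not_free]
  refine ⟨⟨⟨![⟨B₁, h₁⟩, ⟨B₂, h₂⟩, ⟨B₃, h₃⟩], ?_⟩, ?_⟩⟩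
  · intro a b hab
    fin_cases a <;> fin_cases b <;>
      first
        | exact absurd rfl hab.ne
        | assumption
        | (apply Adj.symm; assumption)
  · intro a b hab
    fin_cases a <;> fin_cases b <;>
      first
        | rfl
        | exact absurd hab a₁₂.ne
        | exact absurd hab a₂₃.ne
        | exact absurd hab a₁₃.ne
        | exact absurd hab a₁₂.ne'
        | exact absurd hab a₂₃.ne'
        | exact absurd hab a₁₃.ne'

theorem not_free_cycleGraph_four {B₁ B₂ B₃ B₄ : Finset V} (h₁ : G.IsMinimumZeroForcingSet B₁)
    (h₂ : G.IsMinimumZeroForcingSet B₂) (h₃ : G.IsMinimumZeroForcingSet B₃)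
    (h₄ : G.IsMinimumZeroForcingSet B₄)
    (h₁₂ : (symmDiff B₁ B₂).card = 2) (h₂₃ : (symmDiff B₂ B₃).card = 2)
    (h₃₄ : (symmDiff B₃ B₄).card = 2) (h₁₄ : (symmDiff B₁ B₄).card = 2)
    (h₁₃ : B₁ ≠ B₃) (h₂₄ : B₂ ≠ B₄) : ¬ (cycleGraph 4).Free G.zeroForcingGraph := by
  have a₁₂ : G.zeroForcingGraph.Adj ⟨B₁, h₁⟩ ⟨B₂, h₂⟩ := h₁₂
  have a₂₃ : G.zeroForcingGraph.Adj ⟨B₂, h₂⟩ ⟨B₃, h₃⟩ := h₂₃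
  have a₃₄ : G.zeroForcingGraph.Adj ⟨B₃, h₃⟩ ⟨B₄, h₄⟩ := h₃₄
  have a₁₄ : G.zeroForcingGraph.Adj ⟨B₁, h₁⟩ ⟨B₄, h₄⟩ := h₁₄
  rw [not_free]
  refine ⟨⟨⟨![⟨B₁, h₁⟩, ⟨B₂, h₂⟩, ⟨B₃, h₃⟩, ⟨B₄, h₄⟩], ?_⟩, ?_⟩⟩
  · intro a b hab
    fin_cases a <;> fin_cases b <;>
      first
        | exact absurd rfl hab.ne
        | exact absurd hab (by rw [cycleGraph_adj]; decide)
        | assumption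
        | (apply Adj.symm; assumption)
  · intro a b hab
    fin_cases a <;> fin_cases b <;>
      first
        | rfl
        | exact absurd hab a₁₂.ne
        | exact absurd hab a₂₃.ne
        | exact absurd hab a₃₄.ne
        | exact absurd hab a₁₄.ne
        | exact absurd hab a₁₂.ne'
        | exact absurd hab a₂₃.ne'
        | exact absurd hab a₃₄.ne'
        | exact absurd hab a₁₄.ne'
        | exact absurd (congrArg Subtype.val hab) h₁₃
        | exact absurd (congrArg Subtype.val hab) h₂₄
        | exact absurd (congrArg Subtype.val hab) h₁₃.symm
        | exact absurd (congrArg Subtype.val hab) h₂₄.symm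

theorem IsPathCover.swap_isZeroForcingSet {F : V → V → Prop} (hF : G.IsPathCover F B)
    (hG : G.IsAcyclic) {b e : V} (hb : b ∈ B) (he : ∀ w, ¬ F e w)
    (hbe : Relation.ReflTransGen F b e) : G.IsZeroForcingSet (insert e (B.erase b)) := by
  refine (hF.reverse (C := {v | Relation.ReflTransGen F b v}) (fun x y => hF.mem_chain_iff hb)
    (B' := insert e (B.erase b)) ?_).isZeroForcingSet hG
  intro v
  have h1 := fun h => hF.chain_initial (b := b) (v := v) h
  have h2 := fun h => hF.chain_terminal (b := b) (v := v) he h hbe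
  have h3 : Relation.ReflTransGen F b b := .refl
  simp only [Set.mem_ofPred_eq, Finset.mem_insert, Finset.mem_erase]
  grind

/-- If no path of a minimum path cover is trivial and there are two of them, reversing them
independently gives a 4-cycle. -/
theorem IsPathCover.not_free_cycleGraph_four {F : V → V → Prop} (hF : G.IsPathCover F B)
    (hG : G.IsAcyclic) (hB : G.IsMinimumZeroForcingSet B) {b c : V} (hb : b ∈ B) (hc : c ∈ B)
    (hbc : b ≠ c) (hb' : ∃ w, F b w) (hc' : ∃ w, F c w) :
    ¬ (cycleGraph 4).Free G.zeroForcingGraph := by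
  obtain ⟨e, hbe, he⟩ := hF.exists_terminal hG b
  obtain ⟨f, hcf, hf⟩ := hF.exists_terminal hG c
  have heB : e ∉ B := fun h => by
    obtain rfl := hF.chain_initial h hbe
    exact he _ hb'.choose_spec
  have hfB : f ∉ B := fun h => by
    obtain rfl := hF.chain_initial h hcf
    exact hf _ hc'.choose_spec
  have hef : e ≠ f := by
    rintro rfl
    exact hbc (hF.chain_disjoint hb hc hbe hcf)
  have z1 := hF.swap_isZeroForcingSet hG hb he hbe
  have z2 := hF.swap_isZeroForcingSet hG hc hf hcf
  have z3 : G.IsZeroForcingSet (insert f ((insert e (B.erase b)).erase c)) := by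
    refine (hF.reverse
      (C := {v | Relation.ReflTransGen F b v ∨ Relation.ReflTransGen F c v})
      (fun x y h => or_congr (hF.mem_chain_iff hb h) (hF.mem_chain_iff hc h))
      (B' := insert f ((insert e (B.erase b)).erase c)) ?_).isZeroForcingSet hG
    intro v
    have h1 := fun h => hF.chain_initial (b := b) (v := v) h
    have h2 := fun h => hF.chain_terminal (b := b) (v := v) he h hbe
    have h1' := fun h => hF.chain_initial (b := c) (v := v) h
    have h2' := fun h => hF.chain_terminal (b := c) (v := v) hf h hcf
    have h3 : Relation.ReflTransGen F b b := .refl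
    have h3' : Relation.ReflTransGen F c c := .refl
    simp only [Set.mem_ofPred_eq, Finset.mem_insert, Finset.mem_erase]
    grind
  have hcomm : insert f ((insert e (B.erase b)).erase c) =
      insert e ((insert f (B.erase c)).erase b) := by
    have hec : e ≠ c := fun h => heB (h ▸ hc)
    have hfb : f ≠ b := fun h => hfB (h ▸ hb)
    rw [Finset.erase_insert_of_ne hec, Finset.erase_insert_of_ne hfb, Finset.insert_comm,
      Finset.erase_right_comm]
  have m1 := hB.swap hb heB z1
  have m2 := hB.swap hc hfB z2
  have hc1 : c ∈ insert e (B.erase b) := by grind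
  have hf1 : f ∉ insert e (B.erase b) := by grind
  have hb2 : b ∈ insert f (B.erase c) := by grind
  have he2 : e ∉ insert f (B.erase c) := by grind
  have m3 := m1.swap hc1 hf1 z3
  refine SimpleGraph.not_free_cycleGraph_four hB m1 m3 m2 (card_symmDiff_swap hb heB)
    (card_symmDiff_swap hc1 hf1) ?_ (card_symmDiff_swap hc hfB) ?_ ?_
  · rw [hcomm, symmDiff_comm]
    exact card_symmDiff_swap hb2 he2
  · intro h
    exact heB (h ▸ by grind)
  · intro h
    exact he2 (h ▸ by grind)

/-- If a minimum path cover of a tree has a trivial path and at least two paths, then there is a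
triangle. -/
theorem IsPathCover.not_free_cycleGraph_three {F : V → V → Prop} (hF : T.IsPathCover F B)
    (hT : T.IsTree) (hB : T.IsMinimumZeroForcingSet B) {x c : V} (hx : x ∈ B) (hxc : x ≠ c)
    (hx' : ∀ w, ¬ F x w) : ¬ (cycleGraph 3).Free T.zeroForcingGraph := by
  have : Nontrivial V := ⟨x, c, hxc⟩
  have hG := hT.isAcyclic
  have hx₀ := hF.mem_iff.1 hx
  obtain ⟨q, hxq⟩ := hT.connected.preconnected.exists_adj_of_nontrivial x
  have hqB : q ∉ B := fun h => hx₀ _ (hF.rel_of_adj hG hB hx' h hxq)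
  obtain ⟨r, hqr⟩ : ∃ r, F q r := by
    by_contra! h
    exact hx' _ (hF.rel_of_adj hG hB h hx hxq.symm)
  have hrB : r ∉ B := fun h => hF.mem_iff.1 h q hqr
  -- The successor of `q` is changed from `r` to `x`, so `r` becomes initial in place of `x`.
  have hF' : T.IsPathCover (fun a b => (a = q ∧ b = x) ∨ (a ≠ q ∧ F a b))
      (insert r (B.erase x)) := by
    have h1 := @hF.adj
    have h2 := @hF.left
    have h3 := @hF.right
    have h4 := @hF.asymm
    have h5 := @hF.mem_iff
    have h6 := hxq.symm
    refine ⟨?_, ?_, ?_, ?_, ?_⟩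
    · grind
    · grind
    · grind
    · grind
    · intro v
      rw [Finset.mem_insert, Finset.mem_erase]
      constructor
      · grind
      · intro h
        by_cases hv : v = r
        · exact .inl hv
        · refine .inr ⟨fun h' => h q (.inl ⟨rfl, h'⟩), h5.2 fun u hu => h u (.inr ⟨?_, hu⟩)⟩
          rintro rfl
          exact hv (h3 hu hqr)
  obtain ⟨b, hb, hbx⟩ := hF'.exists_initial hG x
  have hbx' : b ≠ x := by
    rintro rfl
    exact hF'.mem_iff.1 hb q (.inl ⟨rfl, rfl⟩)
  -- If the chain ending in `x` began at `r`, then `r` would reach `q` in the old cover, closing a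
  -- cycle with `q → r`.
  have hbr : b ≠ r := by
    rintro rfl
    rcases hbx.cases_tail with h | ⟨z, hz, h | h⟩
    · exact hbx' h.symm
    · obtain ⟨rfl, -⟩ := h
      refine hF.not_reflTransGen_of_rel hG hqr ?_
      clear hb hbx hbx' hqr hrB hF'
      induction hz using Relation.ReflTransGen.head_induction_on with
      | refl => exact .refl
      | head h _ ih =>
        rcases h with ⟨rfl, -⟩ | ⟨-, h⟩
        · exact .refl
        · exact ih.head h
    · exact hx₀ z h.2
  have hbB : b ∈ B := by grind
  have z1 := hF'.isZeroForcingSet hG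
  have z2 := hF'.swap_isZeroForcingSet hG hb (e := x) (by grind [hxq.ne]) hbx
  have heq : insert x ((insert r (B.erase x)).erase b) = insert r (B.erase b) := by grind
  have hx1 : x ∉ insert r (B.erase x) := by grind
  have d := card_symmDiff_swap hb hx1
  rw [heq] at z2 d
  exact SimpleGraph.not_free_cycleGraph_three hB (hB.swap hx hrB z1) (hB.swap hbB hrB z2)
    (card_symmDiff_swap hx hrB) d (card_symmDiff_swap hbB hrB)

/-! ### Single chains and path graphs -/

omit [Fintype V] [DecidableEq V] in
theorem IsPathCover.exists_isPath {F : V → V → Prop} (hF : G.IsPathCover F B)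
    (hG : G.IsAcyclic) {a e : V} (h : Relation.ReflTransGen F a e) :
    ∃ p : G.Walk a e, p.IsPath ∧ ∀ i < p.length, F (p.getVert i) (p.getVert (i + 1)) := by
  induction h using Relation.ReflTransGen.head_induction_on with
  | refl => exact ⟨.nil, .nil, by simp⟩
  | @head a b hab _ ih =>
    obtain ⟨p, hp, hpF⟩ := ih
    refine ⟨.cons (hF.adj hab) p, ?_, ?_⟩
    · rw [Walk.cons_isPath_iff]
      refine ⟨hp, fun ha => ?_⟩
      have hs := hG.eq_snd_of_adj_start hp (hF.adj hab).symm ha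
      -- For the trivial walk `p.snd` defaults to `b`, which would make `a = b`.
      have hl : 0 < p.length := by
        by_contra hl
        have hl : p.length = 0 := by omega
        have : p.snd = b := by
          rw [Walk.snd, Walk.getVert_of_length_le _ (by omega)]
          exact (Walk.eq_of_length_eq_zero hl).symm
        exact (hF.adj hab).ne (hs.trans this)
      have := hpF 0 hl
      rw [Walk.getVert_zero, zero_add] at this
      exact hF.asymm hab (hs ▸ this)
    · intro i hi
      cases i with
      | zero => simpa using hab
      | succ i =>
        simp only [Walk.getVert_cons_succ]
        exact hpF i (by simpa using hi)

omit [DecidableEq V] in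
/-- A forest with a path cover consisting of a single path is a path. -/
theorem IsPathCover.isPathGraph {F : V → V → Prop} (hF : T.IsPathCover F B) (hT : T.IsTree)
    (hB : ∀ b ∈ B, ∀ c ∈ B, b = c) : T.IsPathGraph := by
  have hG := hT.isAcyclic
  obtain ⟨v₀⟩ := hT.connected.nonempty
  obtain ⟨b, hb, -⟩ := hF.exists_initial hG v₀
  obtain ⟨e, hbe, he⟩ := hF.exists_terminal hG b
  obtain ⟨p, hp, hpF⟩ := hF.exists_isPath hG hbe
  have hsurj : ∀ v, ∃ i ≤ p.length, p.getVert i = v := by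
    intro v
    obtain ⟨b', hb', hv⟩ := hF.exists_initial hG v
    obtain rfl := hB b hb b' hb'
    induction hv with
    | refl => exact ⟨0, by simp⟩
    | @tail y z _ hyz ih =>
      obtain ⟨i, hi, rfl⟩ := ih
      have hi' : i < p.length := by
        refine lt_of_le_of_ne hi fun h => ?_
        subst h
        rw [Walk.getVert_length] at hyz
        exact he z hyz
      exact ⟨i + 1, hi', hF.right (hpF i hi') hyz⟩
  have hadj : ∀ i j, i < j → j ≤ p.length → T.Adj (p.getVert i) (p.getVert j) → j = i + 1 := by
    intro i j hij hj h
    have hq : ((p.drop i).take (j - i)).IsPath := (hp.drop i).take _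
    have hij' : (p.drop i).getVert (j - i) = p.getVert j := by
      rw [Walk.drop_getVert]; congr 1; omega
    have hq' : (((p.drop i).take (j - i)).copy rfl hij').IsPath := by simpa using hq
    -- The edge and the segment of `p` between its ends are both paths, hence equal in a forest.
    have h1 : (Walk.cons h .nil).IsPath := by simpa using h.ne
    have := congrArg (fun w : T.Path _ _ => w.1.length) 
      ((hG.subsingleton_path _ _).elim ⟨_, hq'⟩ ⟨_, h1⟩)
    simp [Walk.take_length, Walk.drop_length] at this
    omega
  refine ⟨p.length + 1, by omega, ⟨RelIso.symm ⟨Equiv.ofBijective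
    (fun i : Fin (p.length + 1) => p.getVert i) ⟨?_, ?_⟩, ?_⟩⟩⟩
  · intro i j hij
    have hi : (i : ℕ) ∈ {n | n ≤ p.length} := Nat.lt_succ_iff.1 i.2
    have hj : (j : ℕ) ∈ {n | n ≤ p.length} := Nat.lt_succ_iff.1 j.2
    exact Fin.ext (hp.getVert_injOn hi hj hij)
  · intro v
    obtain ⟨i, hi, h⟩ := hsurj v
    exact ⟨⟨i, Nat.lt_succ_iff.2 hi⟩, h⟩
  · intro i j
    rw [pathGraph_adj]
    change T.Adj (p.getVert i) (p.getVert j) ↔ _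
    constructor
    · intro h
      rcases lt_trichotomy i.1 j.1 with hij | hij | hij
      · exact .inl (hadj _ _ hij (Nat.lt_succ_iff.1 j.2) h).symm
      · rw [hij] at h
        exact absurd rfl h.ne
      · exact .inr (hadj _ _ hij (Nat.lt_succ_iff.1 i.2) h.symm).symm
    · rintro (h | h)
      · rw [← h]
        exact p.adj_getVert_succ (by omega)
      · rw [← h]
        exact (p.adj_getVert_succ (by omega)).symm

theorem isPathGraph_of_free (hT : T.IsTree) (h₃ : (cycleGraph 3).Free T.zeroForcingGraph)
    (h₄ : (cycleGraph 4).Free T.zeroForcingGraph) : T.IsPathGraph := by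
  obtain ⟨B, hB⟩ := exists_isMinimumZeroForcingSet T
  obtain ⟨F, hF⟩ := hB.1.exists_isPathCover
  refine hF.isPathGraph hT fun b hb c hc => ?_
  by_contra hbc
  by_cases hb' : ∃ w, F b w
  · by_cases hc' : ∃ w, F c w
    · exact hF.not_free_cycleGraph_four hT.isAcyclic hB hb hc hbc hb' hc' h₄
    · exact hF.not_free_cycleGraph_three hT hB hc (Ne.symm hbc) (not_exists.1 hc') h₃
  · exact hF.not_free_cycleGraph_three hT hB hb hbc (not_exists.1 hb') h₃

/-- Minimum zero forcing sets of a path consist of an end vertex. -/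
theorem IsMinimumZeroForcingSet.eq_singleton_of_iso {n : ℕ} (hT : T.IsTree)
    (φ : T ≃g pathGraph n) (hB : T.IsMinimumZeroForcingSet B) :
    ∃ v, B = {v} ∧ ((φ v : ℕ) = 0 ∨ (φ v : ℕ) + 1 = n) := by
  obtain ⟨v₀⟩ := hT.connected.nonempty
  have hn : 0 < n := (φ v₀).pos
  have hcov : T.IsPathCover (fun u v => (φ u : ℕ) + 1 = φ v) {φ.symm ⟨0, hn⟩} := by
    refine ⟨?_, ?_, ?_, ?_, ?_⟩
    · intro u v h
      rw [← φ.map_adj_iff, pathGraph_adj]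
      exact .inl h
    · intro u u' v h h'
      exact φ.injective (Fin.ext (by omega))
    · intro u u' v h h'
      exact φ.injective (Fin.ext (by omega))
    · intro u v h h'
      omega
    · intro v
      rw [Finset.mem_singleton]
      constructor
      · rintro rfl u
        simp
      · intro h
        by_contra hv
        have h0 : (φ v : ℕ) ≠ 0 := fun h0 => hv (by
          rw [← φ.symm_apply_apply v]
          exact congrArg φ.symm (Fin.ext h0))
        refine h (φ.symm ⟨φ v - 1, by omega⟩) ?_
        simp only [RelIso.apply_symm_apply]
        omega
  have hle := zeroForcingNumber_le_card (hcov.isZeroForcingSet hT.isAcyclic)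
  rw [← hB.2, Finset.card_singleton, Finset.card_le_one] at hle
  obtain ⟨F, hF⟩ := hB.1.exists_isPathCover
  obtain ⟨v, hv, -⟩ := hF.exists_initial hT.isAcyclic v₀
  have hBv : B = {v} := Finset.eq_singleton_iff_unique_mem.2 ⟨hv, fun w hw => hle w hw v hv⟩
  refine ⟨v, hBv, ?_⟩
  subst hBv
  by_contra! hne
  have hprev : (φ (φ.symm ⟨φ v - 1, by omega⟩) : ℕ) + 1 = φ v := by
    simp only [RelIso.apply_symm_apply]
    omega
  have hnext : (φ v : ℕ) + 1 = φ (φ.symm ⟨φ v + 1, by omega⟩) := by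
    simp only [RelIso.apply_symm_apply]
  generalize φ.symm ⟨φ v - 1, _⟩ = x at hprev
  generalize φ.symm ⟨φ v + 1, _⟩ = y at hnext
  have hxv : x ∉ ({v} : Finset V) := by
    rw [Finset.mem_singleton]; rintro rfl; omega
  have hyv : y ∉ ({v} : Finset V) := by
    rw [Finset.mem_singleton]; rintro rfl; omega
  -- An interior vertex has two white neighbors, so it alone cannot make a first force.
  rcases Relation.ReflTransGen.cases_head hB.1 with h | ⟨S, ⟨u, hu, w, -, -, hun, -⟩, -⟩
  · exact hxv (h ▸ Finset.mem_univ x)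
  · rw [Finset.mem_singleton] at hu
    subst hu
    have hx := hun x hxv (by rw [← φ.map_adj_iff, pathGraph_adj]; exact .inr hprev)
    have hy := hun y hyv (by rw [← φ.map_adj_iff, pathGraph_adj]; exact .inl hnext)
    rw [hx] at hprev
    rw [hy] at hnext
    omega

theorem IsPathGraph.free_of_two_lt_card (hT : T.IsTree) (h : T.IsPathGraph) {k : ℕ} (hk : 2 < k)
    (H : SimpleGraph (Fin k)) : H.Free T.zeroForcingGraph := by
  obtain ⟨n, -, ⟨φ⟩⟩ := h
  rintro ⟨⟨f, hf⟩⟩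
  choose v hv hend using fun i => (f i).2.eq_singleton_of_iso hT φ
  -- Pigeonhole on which end of the path the minimum set occupies.
  obtain ⟨i, j, hij, h⟩ := Fintype.exists_ne_map_eq_of_card_lt
    (fun i => decide ((φ (v i) : ℕ) = 0)) (by simpa using hk)
  have hφ : (φ (v i) : ℕ) = φ (v j) := by
    rw [decide_eq_decide] at h
    have := hend i
    have := hend j
    omega
  refine hij (hf (Subtype.ext ?_))
  rw [hv i, hv j, φ.injective (Fin.ext hφ)]

end SimpleGraph

/-- For every finite tree `T`, the zero forcing graph of `T` contains neither a triangle nor a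
4-cycle as a (not necessarily induced) subgraph if and only if `T` is a path. -/
theorem mainTheorem2 {V : Type*} [Fintype V] [DecidableEq V] (T : SimpleGraph V) (hT : T.IsTree) :
    ((SimpleGraph.cycleGraph 3).Free T.zeroForcingGraph ∧
      (SimpleGraph.cycleGraph 4).Free T.zeroForcingGraph) ↔ T.IsPathGraph :=
  ⟨fun h => SimpleGraph.isPathGraph_of_free hT h.1 h.2, fun h =>
    ⟨h.free_of_two_lt_card hT (by norm_num) _, h.free_of_two_lt_card hT (by norm_num) _⟩⟩
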